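/- Digraphs are finite and have no loops or parallel arcs. For digraphs $D$ and $H$, a mapping $f: V(D)\to V(H)$ is a homomorphism of $D$ to $H$ if $uv\in A(D)$ implies $f(u)f(v)\in A(H)$. For a fixed digraph $H$, the minimum cost homomorphism problem MinHOMP($H$) is the following. Given an input digraph $D$ and a positive integral cost $c_i(u)$ for each $u\in V(D)$ and $i\in V(H)$, decide whether there is a homomorphism of $D$ to $H$ and, if there is one, find a homomorphism $f$ of $D$ to $H$ whose cost $\sum_{u\in V(D)}c_{f(u)}(u)$ is minimum. MinHOMP($H$) is polynomial-time solvable if some Turing machine solves it in a number of steps that is bounded by a polynomial in the length of the encoded input, with the costs written in binary. A digraph $H'$ is an extension of $H$ if it is obtained from $H$ by replacing every vertex $x$ of $H$ with a nonempty set $S_x$ of independent vertices (the sets $S_x$ are pairwise disjoint), so that for distinct $x,y\in V(H)$ and $u\in S_x$, $v\in S_y$ we have $uv\in A(H')$ if and only if $xy\in A(H)$. **Lemma.** Suppose that MinHOMP($H$) is polynomial-time solvable. Then, for each extension $H'$ of $H$, MinHOMP($H'$) is also polynomial-time solvable. -/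

import Mathlib

namespace MinHom

/-- Digraphs have no loops. Parallel arcs do not exist, as `Digraph V` is a relation on `V`. -/
def Loopless {V : Type*} (G : Digraph V) : Prop :=
  ∀ v, ¬ G.Adj v v

/-- `f` is a homomorphism of `D` to `H` (an `H`-coloring of `D`). -/
def IsHom {U V : Type*} (D : Digraph U) (H : Digraph V) (f : U → V) : Prop :=
  ∀ ⦃u v⦄, D.Adj u v → H.Adj (f u) (f v)

/-- `H'` is an extension of `H`: every vertex `x` of `H` is replaced by a nonempty set `S_x` of
independent vertices. The sets `S_x` are the fibres of `p`, so they partition the vertex set of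
`H'`; between different sets `S_x` and `S_y` there are the arcs `uv` (`u ∈ S_x`, `v ∈ S_y`) with
`xy` an arc of `H`, and no others. -/
def IsExtension {V' V : Type*} (H' : Digraph V') (H : Digraph V) : Prop :=
  ∃ p : V' → V, Function.Surjective p ∧
    (∀ u v, p u = p v → ¬ H'.Adj u v) ∧
    (∀ u v, p u ≠ p v → (H'.Adj u v ↔ H.Adj (p u) (p v)))

/-- An input of the minimum cost homomorphism problem for a digraph with vertex set `V`: a finite
loopless digraph `D` (with vertices `0, …, n - 1`), and a positive integral cost `cost u i`
for every vertex `u` of `D` and every `i` in `V`. -/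
structure Input (V : Type) where
  /-- the number of vertices of the input digraph -/
  n : ℕ
  /-- the input digraph -/
  D : Digraph (Fin n)
  loopless : Loopless D
  /-- the cost of mapping `u` to `i` -/
  cost : Fin n → V → ℕ
  cost_pos : ∀ u i, 0 < cost u i

namespace Input

variable {V : Type} (I : Input V)

/-- The cost of a mapping from the vertices of the input digraph to `V`. -/
def totalCost (f : Fin I.n → V) : ℕ :=
  ∑ u, I.cost u (f u)

/-- What a correct answer is: `none` if there is no homomorphism of the input digraph to `H`, and
a homomorphism of minimum cost if there is one. -/
def IsAnswer (H : Digraph V) : Option (Fin I.n → V) → Prop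
  | none => ∀ f, ¬ IsHom I.D H f
  | some f => IsHom I.D H f ∧ ∀ g, IsHom I.D H g → I.totalCost f ≤ I.totalCost g

open Classical in
/-- A row of the adjacency matrix of the input digraph, as a word of bits closed by a comma. -/
noncomputable def encodeRow (u : Fin I.n) : List Computability.Γ' :=
  (List.ofFn fun v => Computability.Γ'.bit (decide (I.D.Adj u v))) ++ [Computability.Γ'.comma]

/-- The cost `cost u i` in binary (least significant bit first), closed by a comma. -/
def encodeCost (u : Fin I.n) (i : V) : List Computability.Γ' :=
  Computability.encodingNatΓ'.encode (I.cost u i) ++ [Computability.Γ'.comma]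

/-- The costs at the vertex `u`, in a fixed order of `V`, between brackets. -/
noncomputable def encodeCosts [Fintype V] (u : Fin I.n) : List Computability.Γ' :=
  [Computability.Γ'.bra] ++ (Finset.univ : Finset V).toList.flatMap (I.encodeCost u) ++
    [Computability.Γ'.ket]

/-- The input as a word: the adjacency matrix row by row, between brackets, and then the costs,
vertex by vertex. -/
noncomputable def encode [Fintype V] : List Computability.Γ' :=
  [Computability.Γ'.bra] ++ (List.finRange I.n).flatMap I.encodeRow ++ [Computability.Γ'.ket] ++
    (List.finRange I.n).flatMap I.encodeCosts

end Input

/-- An answer as a word over the alphabet `Option V`: the one-letter word `none` for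
"no homomorphism", and the sequence of the colors of the vertices `0, …, n - 1` for a mapping. -/
def encodeAnswer {V : Type} {n : ℕ} : Option (Fin n → V) → List (Option V)
  | none => [none]
  | some f => List.ofFn fun u => some (f u)

/-- The minimum cost homomorphism problem for the (fixed) digraph `H` is polynomial-time solvable:
some Turing machine writes, on every input, the encoding of a correct answer, within a number of
steps that is bounded by a polynomial in the length of the encoded input. -/
def PolyTimeSolvable {V : Type} [Fintype V] (H : Digraph V) : Prop :=
  ∃ answer : (I : Input V) → Option (Fin I.n → V),
    (∀ I : Input V, I.IsAnswer H (answer I)) ∧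
    Nonempty (Turing.TM2ComputableInPolyTime (α := Input V) (β := List (Option V))
      (fun I => I.encode) id (fun I => encodeAnswer (answer I)))

end MinHom

/-! Let `p` be the projection of the extension onto `H`. Arcs of `H'` join different fibres, so a
homomorphism to `H'` followed by `p` is a homomorphism to `H`. Conversely, since `H` is loopless, a
homomorphism to `H` becomes one to `H'` however its values are replaced by elements of their fibres.
It therefore suffices to give each pair `u`, `x` the least cost at `u` in the fibre over `x`, to
solve the resulting input for `H`, and to replace each color by a cheapest element of its fibre
(`Input.isAnswer_lift`).

The reduction is carried out by a machine wrapped around a given machine for `H`. As `V` and `V'`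
are fixed, a whole map `V → V'` is a single letter, and a comparison table on `V'` fits in a
register. For each vertex the costs of all colors are compared in parallel, from the least
significant digit up (`run_compare`). The digits of the cheapest ones go to the input stack of the
inner machine, and the map selecting them is saved. After the inner run (`run_inner`), the saved
maps translate its answer. Stacks reverse what passes through them, so the cost blocks are treated
from the last vertex to the first.

The contracted encoding is no longer than the original: distinct vertices of `H` have distinct
representatives, so its costs are among the original ones (`Input.length_encode_contract`).
Polynomials over `ℕ` are monotone, so the inner run stays within the polynomial bound; the
additional work is linear in the input length. -/

open Computability

namespace MinHom

/-! ### Cheapest colors and correctness of the reduction. -/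

/-- A section of `p` which takes values that are least for `le` in their fibres, if there are
such values. -/
noncomputable def fibreMin {V V' : Type} {p : V' → V} (hp : Function.Surjective p)
    (le : V' → V' → Bool) (x : V) : V' :=
  open Classical in
  if h : ∃ i, p i = x ∧ ∀ j, p j = x → le i j = true then h.choose
  else Function.surjInv hp x

theorem apply_fibreMin {V V' : Type} {p : V' → V} (hp : Function.Surjective p)
    (le : V' → V' → Bool) (x : V) : p (fibreMin hp le x) = x := by
  unfold fibreMin
  split_ifs with h
  · exact h.choose_spec.1
  · exact Function.surjInv_eq hp x

/-- A section is injective whatever the table `le` is. This keeps the selected digit stacks distinct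
and bounds the length of the contracted input. -/
theorem fibreMin_injective {V V' : Type} {p : V' → V} (hp : Function.Surjective p)
    (le : V' → V' → Bool) : Function.Injective (fibreMin hp le) :=
  Function.LeftInverse.injective (apply_fibreMin hp le)

theorem le_of_fibreMin {V V' : Type} [Finite V'] {p : V' → V} (hp : Function.Surjective p)
    (c : V' → ℕ) (j : V') :
    c (fibreMin hp (fun i j => decide (c i ≤ c j)) (p j)) ≤ c j := by
  -- A finite nonempty fibre attains its minimum, so the fallback value in `fibreMin` does not
  -- occur.
  have h : ∃ i, p i = p j ∧ ∀ k, p k = p j → decide (c i ≤ c k) = true := by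
    obtain ⟨i, hi, h⟩ := Set.exists_min_image {i | p i = p j} c (Set.toFinite _) ⟨j, rfl⟩
    exact ⟨i, hi, fun k hk => decide_eq_true (h k hk)⟩
  unfold fibreMin
  rw [dif_pos h]
  exact of_decide_eq_true (h.choose_spec.2 j rfl)

namespace Input

variable {V V' : Type} {p : V' → V} (hp : Function.Surjective p) (I : Input V')

/-- The cheapest color for the vertex `u` in the fibre over `x`. -/
noncomputable def cheapest (u : Fin I.n) : V → V' :=
  fibreMin hp fun i j => decide (I.cost u i ≤ I.cost u j)

/-- The input for the base digraph of an extension, where the cost of a vertex is the least cost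
in its fibre. -/
noncomputable def contract : Input V where
  n := I.n
  D := I.D
  loopless := I.loopless
  cost u x := I.cost u (I.cheapest hp u x)
  cost_pos _ _ := I.cost_pos _ _

/-- The colors of the extension that correspond to an answer for the contracted input. -/
noncomputable def lift (a : Option (Fin I.n → V)) : Option (Fin I.n → V') :=
  a.map fun f u => I.cheapest hp u (f u)

theorem isAnswer_lift [Finite V'] {H : Digraph V} (hH : Loopless H) {H' : Digraph V'}
    (hind : ∀ u v, p u = p v → ¬ H'.Adj u v)
    (hadj : ∀ u v, p u ≠ p v → (H'.Adj u v ↔ H.Adj (p u) (p v)))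
    (a : Option (Fin I.n → V)) (ha : (I.contract hp).IsAnswer H a) :
    I.IsAnswer H' (I.lift hp a) := by
  have hom : ∀ g, IsHom I.D H' g → IsHom I.D H fun u => p (g u) := fun g hg u v huv =>
    (hadj _ _ fun h => hind _ _ h (hg huv)).1 (hg huv)
  cases a with
  | none => exact fun g hg => ha _ (hom g hg)
  | some f =>
    obtain ⟨hf, hmin⟩ := ha
    -- Any `g` is compared with `f` through `p ∘ g`: minimality bounds the contracted cost of `f` by
    -- that of `p ∘ g`, which is termwise at most the cost of `g`.
    refine ⟨fun u v huv => ?_, fun g hg => (hmin _ (hom g hg)).trans ?_⟩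
    · have h := hf huv
      refine (hadj _ _ ?_).2 ?_
      · simp only [cheapest, apply_fibreMin]
        intro e
        rw [e] at h
        exact hH _ h
      · simpa only [cheapest, apply_fibreMin] using h
    · exact Finset.sum_le_sum fun u _ => le_of_fibreMin hp (I.cost u) (g u)

end Input

/-! ### Comparison of binary numbers, least significant digit first. -/

/-- The binary digits of a natural number, the least significant one first. -/
def bits (n : ℕ) : List Bool := encodeNat n

/-- The number with the given binary digits, the least significant one first. -/
def ofBits (l : List Bool) : ℕ := l.foldr (fun b n => b.toNat + 2 * n) 0

@[simp] theorem ofBits_nil : ofBits [] = 0 := rfl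

@[simp] theorem ofBits_cons (b : Bool) (l : List Bool) :
    ofBits (b :: l) = b.toNat + 2 * ofBits l := rfl

theorem ofBits_encodePosNum (n : PosNum) : ofBits (encodePosNum n) = n := by
  induction n with
  | one => rfl
  | bit0 n ih => simp [encodePosNum, ih, PosNum.cast_bit0]; ring
  | bit1 n ih => simp [encodePosNum, ih, PosNum.cast_bit1]; ring

@[simp] theorem ofBits_bits (n : ℕ) : ofBits (bits n) = n := by
  have h : ∀ m : Num, ofBits (encodeNum m) = m := fun m => by
    cases m with
    | zero => rfl
    | pos m => exact ofBits_encodePosNum m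
  exact (h n).trans (Num.to_of_nat n)

/-- Update of a comparison of two numbers, after the next more significant digits are read. -/
def leStep (a b : Option Bool) (le : Bool) : Bool :=
  if a.getD false = b.getD false then le else b.getD false

/-- Reading one digit preserves the verdict: the higher digits decide first, then the lowest digit,
then the previous verdict `le`. Missing digits count as zero, so the lengths may differ. -/
theorem leStep_lex (a b : List Bool) (le : Bool) :
    decide (ofBits a.tail < ofBits b.tail ∨
      (ofBits a.tail = ofBits b.tail ∧ leStep a.head? b.head? le = true)) =
    decide (ofBits a < ofBits b ∨ (ofBits a = ofBits b ∧ le = true)) := by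
  rw [decide_eq_decide]
  rcases a with _ | ⟨_ | _, a⟩ <;> rcases b with _ | ⟨_ | _, b⟩ <;> cases le <;>
    simp [leStep] <;> omega

end MinHom
open Computability Turing

namespace MinHom

/-! ### The machine for the extension. -/

/-- The work stacks of the machine, with two stacks for each color. -/
inductive WorkStack (V' : Type)
  /-- the input -/
  | inp
  /-- the adjacency matrix -/
  | mat
  /-- the costs, reversed -/
  | rev
  /-- the functions which give the cheapest colors -/
  | sel
  /-- the output, reversed -/
  | tmp
  /-- the output -/
  | out
  /-- the digits of the cost of a color -/
  | digits (i : V')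
  /-- the digits of the cost of a color, after comparison -/
  | seen (i : V')

/-- Duplicate-free lists. -/
abbrev NodupList (α : Type) : Type := {L : List α // L.Nodup}

/-- The labels of the machine. -/
inductive Lab (V V' Λ : Type)
  | readMatrix
  | readCosts
  | block
  | entry (L : NodupList V')
  | digit (i : V') (L : NodupList V')
  | compare
  | emit (L : NodupList V)
  | drain (i : V') (L : NodupList V)
  | clear (L : NodupList V')
  | copyMatrix
  | run (l : Λ)
  | colors
  | reject
  | finish

open Classical in
noncomputable instance {V' : Type} [Fintype V'] : Fintype (WorkStack V') :=
  derive_fintype% _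

open Classical in
noncomputable instance {V V' Λ : Type} [Fintype V] [Fintype V'] [Fintype Λ] :
    Fintype (Lab V V' Λ) :=
  derive_fintype% _

/-- The alphabets of the work stacks. -/
def WorkStack.Alphabet (V V' : Type) : WorkStack V' → Type
  | inp | mat | rev => Γ'
  | sel => V → V'
  | tmp | out => Option V'
  | digits _ => Bool
  | seen _ => Option Bool

/-- The registers of the machine. -/
structure Reg (V V' : Type) where
  le : V' → V' → Bool
  digit : V' → Option Bool
  sym : Option Γ'
  pad : Option (Option Bool)
  color : Option (Option V)
  sel : Option (V → V')
  color' : Option (Option V')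

instance {V V' : Type} [Finite V] [Finite V'] : Finite (Reg V V') :=
  Finite.of_injective
    (fun r : Reg V V' => (r.le, r.digit, r.sym, r.pad, r.color, r.sel, r.color'))
    fun a b h => by cases a; cases b; simp_all

noncomputable instance {V V' : Type} [Fintype V] [Fintype V'] : Fintype (Reg V V') :=
  Fintype.ofFinite _

/-- The initial values of the registers. -/
def Reg.init (V V' : Type) : Reg V V' :=
  ⟨fun _ _ => true, fun _ => none, none, none, none, none, none⟩

/-- The alphabets of the stacks of a machine together with the work stacks. -/
def Alphabet (V V' : Type) (tm : FinTM2) : tm.K ⊕ WorkStack V' → Type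
  | .inl k => tm.Γ k
  | .inr k => k.Alphabet V V'

section machine

variable {V V' : Type} (tm : FinTM2) (eI : tm.Γ tm.k₀ ≃ Γ') (eO : tm.Γ tm.k₁ ≃ Option V)
  [Fintype V] [Fintype V'] (choice : (V' → V' → Bool) → V → V')

/-- The statements of the machine. -/
abbrev MStmt (V V' : Type) (tm : FinTM2) : Type :=
  TM2.Stmt (Alphabet V V' tm) (Lab V V' tm.Λ) (tm.σ × Reg V V')

open TM2.Stmt

/-- A statement of the inner machine as a statement of the machine. -/
def embed : TM2.Stmt tm.Γ tm.Λ tm.σ → MStmt V V' tm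
  | push k f q => push (.inl k) (fun v => f v.1) (embed q)
  | peek k f q => peek (.inl k) (fun v o => (f v.1 o, v.2)) (embed q)
  | pop k f q => pop (.inl k) (fun v o => (f v.1 o, v.2)) (embed q)
  | load f q => load (fun v => (f v.1, v.2)) (embed q)
  | branch f q r => branch (fun v => f v.1) (embed q) (embed r)
  | goto f => goto fun v => .run (f v.1)
  | halt => goto fun _ => .colors

open Classical in
/-- Pop a digit from each of the given stacks into the registers, and store it. -/
noncomputable def popDigits (q : MStmt V V' tm) : List V' → MStmt V V' tm
  | [] => q
  | i :: L =>
    pop (.inr (.digits i)) (fun v o => (v.1, { v.2 with digit := Function.update v.2.digit i o }))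
      (push (.inr (.seen i)) (fun v => v.2.digit i) (popDigits q L))

/-- All elements in the order of the encoding. -/
noncomputable def allList (α : Type) [Fintype α] : NodupList α :=
  ⟨(Finset.univ : Finset α).toList, Finset.nodup_toList _⟩

/-- All elements in the reverse order of the encoding. -/
noncomputable def revList (α : Type) [Fintype α] : NodupList α :=
  ⟨(Finset.univ : Finset α).toList.reverse, List.nodup_reverse.2 (Finset.nodup_toList _)⟩

open Classical in
/-- The program of the machine. -/
noncomputable def program : Lab V V' tm.Λ → MStmt V V' tm
  | .readMatrix =>
    pop (.inr .inp) (fun v o => (v.1, { v.2 with sym := o })) <|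
    push (.inr .mat) (fun v => v.2.sym.getD .blank) <|
    goto fun v => if v.2.sym = some .ket then .readCosts else .readMatrix
  | .readCosts =>
    pop (.inr .inp) (fun v o => (v.1, { v.2 with sym := o })) <|
    branch (fun v => v.2.sym.isNone) (goto fun _ => .block) <|
    push (.inr .rev) (fun v => v.2.sym.getD .blank) <|
    goto fun _ => .readCosts
  | .block =>
    pop (.inr .rev) (fun v o => (v.1, { v.2 with sym := o })) <|
    branch (fun v => v.2.sym.isNone) (goto fun _ => .copyMatrix) <|
    push (.inl tm.k₀) (fun _ => eI.symm .ket) <|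
    goto fun _ => .entry (revList V')
  | .entry ⟨[], _⟩ =>
    -- The popped symbol is the `bra` that ends the reversed block. Starting from the constant table
    -- `true` makes the comparison non-strict.
    pop (.inr .rev) (fun v _ => v) <|
    load (fun v => (v.1, { v.2 with le := fun _ _ => true })) <|
    goto fun _ => .compare
  | .entry ⟨i :: L, h⟩ =>
    pop (.inr .rev) (fun v _ => v) <|
    goto fun _ => .digit i ⟨L, h.of_cons⟩
  | .digit i L =>
    peek (.inr .rev) (fun v o => (v.1, { v.2 with sym := o })) <|
    branch (fun v => v.2.sym = some (.bit true) ∨ v.2.sym = some (.bit false))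
      (pop (.inr .rev) (fun v _ => v) <|
       push (.inr (.digits i)) (fun v => decide (v.2.sym = some (.bit true))) <|
       goto fun _ => .digit i L)
      (goto fun _ => .entry L)
  | .compare =>
    popDigits tm
      (load (fun v => (v.1,
        { v.2 with le := fun i j => leStep (v.2.digit i) (v.2.digit j) (v.2.le i j) })) <|
      branch (fun v => decide (∀ i, v.2.digit i = none))
        (push (.inr .sel) (fun v => choice v.2.le) <| goto fun _ => .emit (revList V))
        (goto fun _ => .compare))
      (allList V').1
  | .emit ⟨[], _⟩ =>
    push (.inl tm.k₀) (fun _ => eI.symm .bra) <|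
    goto fun _ => .clear (allList V')
  | .emit ⟨x :: L, h⟩ =>
    push (.inl tm.k₀) (fun _ => eI.symm .comma) <|
    goto fun v => .drain (choice v.2.le x) ⟨L, h.of_cons⟩
  | .drain i L =>
    pop (.inr (.seen i)) (fun v o => (v.1, { v.2 with pad := o })) <|
    branch (fun v => v.2.pad.isNone) (goto fun _ => .emit L) <|
    branch (fun v => v.2.pad = some none) (goto fun _ => .drain i L) <|
    push (.inl tm.k₀) (fun v => eI.symm (.bit (v.2.pad = some (some true)))) <|
    goto fun _ => .drain i L
  | .clear ⟨[], _⟩ => goto fun _ => .block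
  | .clear ⟨i :: L, h⟩ =>
    pop (.inr (.seen i)) (fun v o => (v.1, { v.2 with pad := o })) <|
    branch (fun v => v.2.pad.isNone) (goto fun _ => .clear ⟨L, h.of_cons⟩)
      (goto fun _ => .clear ⟨i :: L, h⟩)
  | .copyMatrix =>
    pop (.inr .mat) (fun v o => (v.1, { v.2 with sym := o })) <|
    branch (fun v => v.2.sym.isNone) (goto fun _ => .run tm.main) <|
    push (.inl tm.k₀) (fun v => eI.symm (v.2.sym.getD .blank)) <|
    goto fun _ => .copyMatrix
  | .run l => embed tm (tm.m l)
  | .colors =>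
    pop (.inl tm.k₁) (fun v o => (v.1, { v.2 with color := o.map eO })) <|
    branch (fun v => v.2.color.isNone) (goto fun _ => .finish) <|
    pop (.inr .sel) (fun v o => (v.1, { v.2 with sel := o })) <|
    -- If the letter read is `none`, the same push writes the letter `none`, the answer "no
    -- homomorphism".
    push (.inr .tmp) (fun v => v.2.color.bind fun c => c.bind fun x => v.2.sel.map fun s => s x) <|
    branch (fun v => v.2.color = some none) (goto fun _ => .reject) <|
    goto fun _ => .colors
  | .reject =>
    pop (.inr .sel) (fun v o => (v.1, { v.2 with sel := o })) <|
    branch (fun v => v.2.sel.isNone) (goto fun _ => .finish) (goto fun _ => .reject)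
  | .finish =>
    pop (.inr .tmp) (fun v o => (v.1, { v.2 with color' := o })) <|
    branch (fun v => v.2.color'.isNone)
      (load (fun v => (v.1, .init V V')) halt) <|
    push (.inr .out) (fun v => v.2.color'.getD none) <|
    goto fun _ => .finish

open Classical in
/-- The machine for an extension, built around a machine `tm` for the base digraph. -/
noncomputable def extMachine : FinTM2 where
  K := tm.K ⊕ WorkStack V'
  kDecidableEq := Classical.decEq _
  kFin := letI := tm.kFin; inferInstance
  k₀ := .inr .inp
  k₁ := .inr .out
  Γ := Alphabet V V' tm
  Λ := Lab V V' tm.Λ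
  main := .readMatrix
  ΛFin := letI := tm.ΛFin; inferInstance
  σ := tm.σ × Reg V V'
  initialState := (tm.initialState, .init V V')
  σFin := letI := tm.σFin; inferInstance
  Γk₀Fin := inferInstanceAs (Fintype Γ')
  m := program tm eI eO choice

end machine

/-! ### Reachability within a time bound. -/

/-- `b` is reached from `a` in at most `t` steps of `f`. -/
def ReachesIn {S : Type*} (f : S → Option S) (t : ℕ) (a b : S) : Prop :=
  ∃ n ≤ t, (flip bind f)^[n] (some a) = some b

namespace ReachesIn

variable {S : Type*} {f : S → Option S} {t t' : ℕ} {a b c : S}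

theorem refl (t : ℕ) (a : S) : ReachesIn f t a a := ⟨0, t.zero_le, rfl⟩

theorem mono (h : ReachesIn f t a b) (ht : t ≤ t') : ReachesIn f t' a b :=
  let ⟨n, hn, e⟩ := h
  ⟨n, hn.trans ht, e⟩

theorem trans (h : ReachesIn f t a b) (h' : ReachesIn f t' b c) : ReachesIn f (t + t') a c := by
  obtain ⟨n, hn, e⟩ := h
  obtain ⟨n', hn', e'⟩ := h'
  refine ⟨n' + n, by omega, ?_⟩
  rw [Function.iterate_add_apply, e, e']

theorem single (h : f a = some b) : ReachesIn f 1 a b := ⟨1, le_rfl, h⟩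

theorem head (h : f a = some b) (h' : ReachesIn f t b c) : ReachesIn f (t + 1) a c :=
  ((single h).trans h').mono (by omega)

end ReachesIn

/-! ### Stack contents and the effect of single statements. -/

/-- The contents of all stacks. -/
structure Stacks (V V' : Type) (tm : FinTM2) where
  inner : ∀ k, List (tm.Γ k)
  inp : List Γ'
  mat : List Γ'
  rev : List Γ'
  sel : List (V → V')
  tmp : List (Option V')
  out : List (Option V')
  digits : V' → List Bool
  seen : V' → List (Option Bool)

namespace Stacks

variable {V V' : Type} {tm : FinTM2}

/-- The contents of all stacks, as a function. -/
def get (s : Stacks V V' tm) : ∀ k, List (Alphabet V V' tm k)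
  | .inl k => s.inner k
  | .inr .inp => s.inp
  | .inr .mat => s.mat
  | .inr .rev => s.rev
  | .inr .sel => s.sel
  | .inr .tmp => s.tmp
  | .inr .out => s.out
  | .inr (.digits i) => s.digits i
  | .inr (.seen i) => s.seen i

section stepAux

open TM2 TM2.Stmt

section general

variable {K : Type} [DecidableEq K] {Γ : K → Type} {Λ σ : Type} {S S' : ∀ k, List (Γ k)} {k : K}
  (v : σ) (q : Stmt Γ Λ σ)

/-- The new contents `S'` are specified by their values rather than as a `Function.update`, so that
a record update of `Stacks` can be supplied for them. -/
theorem stepAux_push (f : σ → Γ k) (h : S' k = f v :: S k) (h' : ∀ j, j ≠ k → S' j = S j) :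
    stepAux (push k f q) v S = stepAux q v S' :=
  congrArg (stepAux q v) (Function.update_eq_iff.2 ⟨h.symm, fun j hj => (h' j hj).symm⟩)

theorem stepAux_pop (f : σ → Option (Γ k) → σ) (h : S' k = (S k).tail)
    (h' : ∀ j, j ≠ k → S' j = S j) :
    stepAux (pop k f q) v S = stepAux q (f v (S k).head?) S' :=
  congrArg (stepAux q _) (Function.update_eq_iff.2 ⟨h.symm, fun j hj => (h' j hj).symm⟩)

end general

variable {Λ σ : Type} [DecidableEq (tm.K ⊕ WorkStack V')] (s : Stacks V V' tm) (v : σ)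
  (q : Stmt (Alphabet V V' tm) Λ σ)

@[simp] theorem stepAux_push_inner [DecidableEq tm.K] (k : tm.K) (f : σ → tm.Γ k) :
    stepAux (push (.inl k) f q) v s.get =
      stepAux q v { s with inner := Function.update s.inner k (f v :: s.inner k) }.get :=
  stepAux_push _ _ _ (Function.update_self ..) (by
    rintro (j | _ | _) h
    · exact Function.update_of_ne (fun e => h (by rw [e])) ..
    all_goals rfl)

@[simp] theorem stepAux_pop_inner [DecidableEq tm.K] (k : tm.K)
    (f : σ → Option (Alphabet V V' tm (.inl k)) → σ) :
    stepAux (pop (.inl k) f q) v s.get =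
      stepAux q (f v (s.inner k).head?)
        { s with inner := Function.update s.inner k (s.inner k).tail }.get :=
  stepAux_pop _ _ _ (Function.update_self ..) (by
    rintro (j | _ | _) h
    · exact Function.update_of_ne (fun e => h (by rw [e])) ..
    all_goals rfl)

@[simp] theorem stepAux_pop_inp (f : σ → Option (Alphabet V V' tm (.inr .inp)) → σ) :
    stepAux (pop (.inr .inp) f q) v s.get =
      stepAux q (f v s.inp.head?) { s with inp := s.inp.tail }.get :=
  stepAux_pop _ _ _ rfl (by rintro (_ | _ | _) h <;> first | rfl | exact absurd rfl h)

@[simp] theorem stepAux_push_mat (f : σ → Γ') :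
    stepAux (push (.inr .mat) f q) v s.get =
      stepAux q v { s with mat := f v :: s.mat }.get :=
  stepAux_push _ _ _ rfl (by rintro (_ | _ | _) h <;> first | rfl | exact absurd rfl h)

@[simp] theorem stepAux_pop_mat (f : σ → Option (Alphabet V V' tm (.inr .mat)) → σ) :
    stepAux (pop (.inr .mat) f q) v s.get =
      stepAux q (f v s.mat.head?) { s with mat := s.mat.tail }.get :=
  stepAux_pop _ _ _ rfl (by rintro (_ | _ | _) h <;> first | rfl | exact absurd rfl h)

@[simp] theorem stepAux_push_rev (f : σ → Γ') :
    stepAux (push (.inr .rev) f q) v s.get =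
      stepAux q v { s with rev := f v :: s.rev }.get :=
  stepAux_push _ _ _ rfl (by rintro (_ | _ | _) h <;> first | rfl | exact absurd rfl h)

@[simp] theorem stepAux_pop_rev (f : σ → Option (Alphabet V V' tm (.inr .rev)) → σ) :
    stepAux (pop (.inr .rev) f q) v s.get =
      stepAux q (f v s.rev.head?) { s with rev := s.rev.tail }.get :=
  stepAux_pop _ _ _ rfl (by rintro (_ | _ | _) h <;> first | rfl | exact absurd rfl h)

@[simp] theorem stepAux_peek_rev (f : σ → Option (Alphabet V V' tm (.inr .rev)) → σ) :
    stepAux (peek (.inr .rev) f q) v s.get = stepAux q (f v s.rev.head?) s.get := rfl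

@[simp] theorem stepAux_push_sel (f : σ → V → V') :
    stepAux (push (.inr .sel) f q) v s.get =
      stepAux q v { s with sel := f v :: s.sel }.get :=
  stepAux_push _ _ _ rfl (by rintro (_ | _ | _) h <;> first | rfl | exact absurd rfl h)

@[simp] theorem stepAux_pop_sel (f : σ → Option (Alphabet V V' tm (.inr .sel)) → σ) :
    stepAux (pop (.inr .sel) f q) v s.get =
      stepAux q (f v s.sel.head?) { s with sel := s.sel.tail }.get :=
  stepAux_pop _ _ _ rfl (by rintro (_ | _ | _) h <;> first | rfl | exact absurd rfl h)

@[simp] theorem stepAux_push_tmp (f : σ → Option V') :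
    stepAux (push (.inr .tmp) f q) v s.get =
      stepAux q v { s with tmp := f v :: s.tmp }.get :=
  stepAux_push _ _ _ rfl (by rintro (_ | _ | _) h <;> first | rfl | exact absurd rfl h)

@[simp] theorem stepAux_pop_tmp (f : σ → Option (Alphabet V V' tm (.inr .tmp)) → σ) :
    stepAux (pop (.inr .tmp) f q) v s.get =
      stepAux q (f v s.tmp.head?) { s with tmp := s.tmp.tail }.get :=
  stepAux_pop _ _ _ rfl (by rintro (_ | _ | _) h <;> first | rfl | exact absurd rfl h)

@[simp] theorem stepAux_push_out (f : σ → Option V') :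
    stepAux (push (.inr .out) f q) v s.get =
      stepAux q v { s with out := f v :: s.out }.get :=
  stepAux_push _ _ _ rfl (by rintro (_ | _ | _) h <;> first | rfl | exact absurd rfl h)

@[simp] theorem stepAux_push_digits [DecidableEq V'] (i : V') (f : σ → Bool) :
    stepAux (push (.inr (.digits i)) f q) v s.get =
      stepAux q v
        { s with digits := Function.update s.digits i (f v :: s.digits i) }.get :=
  stepAux_push _ _ _ (Function.update_self ..) (by
    rintro (j | _ | _ | _ | _ | _ | _ | j | j) h <;>
      first | rfl | exact Function.update_of_ne (fun e => h (by rw [e])) ..)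

@[simp] theorem stepAux_pop_digits [DecidableEq V'] (i : V')
    (f : σ → Option (Alphabet V V' tm (.inr (.digits i))) → σ) :
    stepAux (pop (.inr (.digits i)) f q) v s.get =
      stepAux q (f v (s.digits i).head?)
        { s with digits := Function.update s.digits i (s.digits i).tail }.get :=
  stepAux_pop _ _ _ (Function.update_self ..) (by
    rintro (j | _ | _ | _ | _ | _ | _ | j | j) h <;>
      first | rfl | exact Function.update_of_ne (fun e => h (by rw [e])) ..)

@[simp] theorem stepAux_push_seen [DecidableEq V'] (i : V') (f : σ → Option Bool) :
    stepAux (push (.inr (.seen i)) f q) v s.get =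
      stepAux q v { s with seen := Function.update s.seen i (f v :: s.seen i) }.get :=
  stepAux_push _ _ _ (Function.update_self ..) (by
    rintro (j | _ | _ | _ | _ | _ | _ | j | j) h <;>
      first | rfl | exact Function.update_of_ne (fun e => h (by rw [e])) ..)

@[simp] theorem stepAux_pop_seen [DecidableEq V'] (i : V')
    (f : σ → Option (Alphabet V V' tm (.inr (.seen i))) → σ) :
    stepAux (pop (.inr (.seen i)) f q) v s.get =
      stepAux q (f v (s.seen i).head?)
        { s with seen := Function.update s.seen i (s.seen i).tail }.get :=
  stepAux_pop _ _ _ (Function.update_self ..) (by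
    rintro (j | _ | _ | _ | _ | _ | _ | j | j) h <;>
      first | rfl | exact Function.update_of_ne (fun e => h (by rw [e])) ..)

end stepAux

end Stacks

/-! ### Initial and final configurations. -/

/-- The contents of the stacks of a machine when only the stack `k` is used. -/
def onlyStack (tm : FinTM2) (k : tm.K) (w : List (tm.Γ k)) : ∀ k, List (tm.Γ k) :=
  Function.update (fun _ => []) k w

@[simp] theorem onlyStack_self (tm : FinTM2) (k : tm.K) (w : List (tm.Γ k)) :
    onlyStack tm k w k = w := Function.update_self ..

@[simp] theorem update_onlyStack (tm : FinTM2) (k : tm.K) (w x : List (tm.Γ k)) :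
    Function.update (onlyStack tm k w) k x = onlyStack tm k x := Function.update_idem ..

theorem initList_eq (tm : FinTM2) (w : List (tm.Γ tm.k₀)) :
    initList tm w = ⟨some tm.main, tm.initialState, onlyStack tm tm.k₀ w⟩ := by
  unfold initList onlyStack
  congr 1
  funext k
  by_cases h : k = tm.k₀
  · subst h
    rw [dif_pos rfl, Function.update_self]
    rfl
  · rw [dif_neg h, Function.update_of_ne h]

theorem haltList_eq (tm : FinTM2) (w : List (tm.Γ tm.k₁)) :
    haltList tm w = ⟨none, tm.initialState, onlyStack tm tm.k₁ w⟩ := by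
  unfold haltList onlyStack
  congr 1
  funext k
  by_cases h : k = tm.k₁
  · subst h
    rw [dif_pos rfl, Function.update_self]
    rfl
  · rw [dif_neg h, Function.update_of_ne h]

/-! ### Reading the input and collecting digits. -/

section phases

variable {V V' : Type} (tm : FinTM2) (eI : tm.Γ tm.k₀ ≃ Γ') (eO : tm.Γ tm.k₁ ≃ Option V)
  [Fintype V] [Fintype V'] (choice : (V' → V' → Bool) → V → V')

/-- The step function of the machine. -/
noncomputable def extStep :
    TM2.Cfg (Alphabet V V' tm) (Lab V V' tm.Λ) (tm.σ × Reg V V') →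
      Option (TM2.Cfg (Alphabet V V' tm) (Lab V V' tm.Λ) (tm.σ × Reg V V')) :=
  @TM2.step _ _ _ _ (Classical.decEq _) (program tm eI eO choice)

variable {tm}

/-- A configuration of the machine in which the inner machine is in its initial state. -/
def cfg (l : Lab V V' tm.Λ) (r : Reg V V') (s : Stacks V V' tm) :
    TM2.Cfg (Alphabet V V' tm) (Lab V V' tm.Λ) (tm.σ × Reg V V') :=
  ⟨some l, (tm.initialState, r), s.get⟩

theorem extStep_cfg (l : Lab V V' tm.Λ) (r : Reg V V') (s : Stacks V V' tm) :
    extStep tm eI eO choice (cfg l r s) =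
      some (@TM2.stepAux _ _ _ _ (Classical.decEq _) (program tm eI eO choice l)
        (tm.initialState, r) s.get) := rfl

open Stacks TM2

attribute [-simp] stepAux.eq_1 stepAux.eq_2 stepAux.eq_3

local notation "Run" => ReachesIn (extStep tm eI eO choice)

/-- The hypothesis on `X` makes the first `ket` the end of the matrix. Encoded rows satisfy it, as
they contain only bits and commas. -/
theorem run_readMatrix (X Y : List Γ') (hX : Γ'.ket ∉ X) (r : Reg V V') (s : Stacks V V' tm)
    (hs : s.inp = X ++ Γ'.ket :: Y) :
    ∃ r', Run (X.length + 1) (cfg .readMatrix r s)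
      (cfg .readCosts r' { s with inp := Y, mat := Γ'.ket :: X.reverse ++ s.mat }) := by
  induction X generalizing r s with
  | nil =>
    refine ⟨{ r with sym := some .ket }, .head ?_ (.refl 0 _)⟩
    rw [extStep_cfg]
    simp [program, hs, cfg]
  | cons c X ih =>
    rw [List.mem_cons, not_or] at hX
    obtain ⟨r', h⟩ := ih hX.2 { r with sym := some c }
      { s with inp := X ++ Γ'.ket :: Y, mat := c :: s.mat } rfl
    refine ⟨r', .head ?_ (by simpa using h)⟩
    rw [extStep_cfg]
    simp [program, hs, cfg, Ne.symm hX.1]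

theorem run_readCosts (r : Reg V V') (s : Stacks V V' tm) :
    ∃ r', Run (s.inp.length + 1) (cfg .readCosts r s)
      (cfg .block r' { s with inp := [], rev := s.inp.reverse ++ s.rev }) := by
  obtain ⟨Y, hY⟩ : ∃ Y, s.inp = Y := ⟨_, rfl⟩
  rw [hY]
  induction Y generalizing r s with
  | nil =>
    refine ⟨{ r with sym := none }, .head ?_ (.refl 0 _)⟩
    rw [extStep_cfg]
    simp [program, hY, cfg]
  | cons c X ih =>
    obtain ⟨r', h⟩ := ih { r with sym := some c } { s with inp := X, rev := c :: s.rev } rfl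
    refine ⟨r', .head ?_ (by simpa using h)⟩
    rw [extStep_cfg]
    simp [program, hY, cfg]

open Classical in
theorem run_digit (i : V') (L : NodupList V') (w : List Bool) (c : Γ') (hc : ∀ b, c ≠ .bit b)
    (R : List Γ') (r : Reg V V') (s : Stacks V V' tm) (hs : s.rev = w.map Γ'.bit ++ c :: R) :
    ∃ r', Run (w.length + 1) (cfg (.digit i L) r s)
      (cfg (.entry L) r' { s with
        rev := c :: R
        digits := Function.update s.digits i (w.reverse ++ s.digits i) }) := by
  induction w generalizing r s with
  | nil =>
    refine ⟨{ r with sym := some c }, .head ?_ (.refl 0 _)⟩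
    rw [extStep_cfg]
    obtain ⟨_, _, _, _⟩ := s
    simp only [List.map_nil, List.nil_append] at hs
    subst hs
    simp [program, hc, cfg]
  | cons b w ih =>
    obtain ⟨r', h⟩ := ih { r with sym := some (.bit b) }
      { s with
        rev := w.map Γ'.bit ++ c :: R
        digits := Function.update s.digits i (b :: s.digits i) } rfl
    refine ⟨r', .head ?_ (by simpa using h)⟩
    rw [extStep_cfg]
    cases b <;>
      (simp [program, hs, cfg])

open Classical in
theorem run_entry (c : V' → List Bool) (R : List Γ') (L : NodupList V') (r : Reg V V')
    (s : Stacks V V' tm)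
    (hs : s.rev = L.1.flatMap (fun i => Γ'.comma :: (c i).reverse.map Γ'.bit) ++ Γ'.bra :: R)
    (hd : ∀ i ∈ L.1, s.digits i = []) :
    ∃ r' : Reg V V', r'.le = (fun _ _ => true) ∧
      Run (2 * (L.1.flatMap (fun i => Γ'.comma :: (c i).reverse.map Γ'.bit)).length + 1)
        (cfg (.entry L) r s)
        (cfg .compare r' { s with
          rev := R
          digits := fun i => if i ∈ L.1 then c i else s.digits i }) := by
  obtain ⟨L, hL⟩ := L
  induction L generalizing r s with
  | nil =>
    refine ⟨{ r with le := fun _ _ => true }, rfl, .head ?_ (.refl _ _)⟩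
    rw [extStep_cfg]
    simp [program, hs, cfg]
  | cons i L ih =>
    -- `d` is the symbol at which the digits of `i` stop: the comma of the next color, or the
    -- bracket that ends the block.
    obtain ⟨d, R', hd', hR'⟩ : ∃ d R', (∀ b, d ≠ .bit b) ∧
        L.flatMap (fun i => Γ'.comma :: (c i).reverse.map Γ'.bit) ++ Γ'.bra :: R = d :: R' := by
      cases L with
      | nil => exact ⟨.bra, R, by simp, rfl⟩
      | cons j L => exact ⟨.comma, _, by simp, rfl⟩
    rw [List.nodup_cons] at hL
    obtain ⟨r₁, h₁⟩ := run_digit eI eO choice i ⟨L, hL.2⟩ (c i).reverse d hd' R' r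
      { s with rev := (c i).reverse.map Γ'.bit ++ d :: R' } rfl
    obtain ⟨r₂, hle, h₂⟩ := ih r₁
      { s with rev := d :: R', digits := Function.update s.digits i (c i) } hL.2 hR'.symm
      (fun j hj => by
        have : j ≠ i := fun e => hL.1 (e ▸ hj)
        simpa [this] using hd j (List.mem_cons_of_mem _ hj))
    refine ⟨r₂, hle, ?_⟩
    have h₃ : extStep tm eI eO choice (cfg (.entry ⟨i :: L, List.nodup_cons.2 hL⟩) r s) =
        some (cfg (.digit i ⟨L, hL.2⟩) r
          { s with rev := (c i).reverse.map Γ'.bit ++ d :: R' }) := by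
      rw [extStep_cfg]
      simp [program, hs, cfg, ← hR']
    have hd₀ := hd i List.mem_cons_self
    simp only [hd₀, List.reverse_reverse, List.append_nil] at h₁
    have h₄ : (fun j => if j ∈ L then c j else Function.update s.digits i (c i) j) =
        fun j => if j ∈ i :: L then c j else s.digits j := by
      funext j
      by_cases hj : j = i
      · subst hj; simp
      · simp [hj]
    simp only [h₄] at h₂
    refine (ReachesIn.head h₃ (h₁.trans h₂)).mono ?_
    simp
    omega

-- All these pops form one statement, hence take one machine step. Absence of duplicates ensures
-- that each stack is popped only once.
open Classical in
omit [Fintype V] [Fintype V'] in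
theorem stepAux_popDigits [d : DecidableEq (tm.K ⊕ WorkStack V')] (q : MStmt V V' tm)
    (L : List V') (hL : L.Nodup)
    (v : tm.σ × Reg V V') (s : Stacks V V' tm) :
    stepAux (popDigits tm q L) v s.get =
      stepAux q
        (v.1, { v.2 with
          digit := fun i => if i ∈ L then (s.digits i).head? else v.2.digit i })
        { s with
          digits := fun i => if i ∈ L then (s.digits i).tail else s.digits i
          seen := fun i => if i ∈ L then (s.digits i).head? :: s.seen i else s.seen i }.get := by
  induction L generalizing v s with
  | nil => simp [popDigits]
  | cons i L ih =>
    rw [List.nodup_cons] at hL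
    refine (stepAux_pop_digits s v _ i _).trans <| (stepAux_push_seen _ _ _ i _).trans <|
      (ih hL.2 _ _).trans ?_
    have h₁ : (fun j => if j ∈ L then (Function.update s.digits i (s.digits i).tail j).tail
        else Function.update s.digits i (s.digits i).tail j) =
        fun j => if j ∈ i :: L then (s.digits j).tail else s.digits j := by
      funext j
      by_cases hj : j = i
      · subst hj; simp [hL.1]
      · simp [hj]
    have h₂ : (fun j => if j ∈ L then (Function.update s.digits i (s.digits i).tail j).head?
        else Function.update v.2.digit i (s.digits i).head? j) =
        fun j => if j ∈ i :: L then (s.digits j).head? else v.2.digit j := by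
      funext j
      by_cases hj : j = i
      · subst hj; simp [hL.1]
      · simp [hj]
    have h₃ : (fun j => if j ∈ L then (Function.update s.digits i (s.digits i).tail j).head? ::
          Function.update s.seen i ((s.digits i).head? :: s.seen i) j
        else Function.update s.seen i ((s.digits i).head? :: s.seen i) j) =
        fun j => if j ∈ i :: L then (s.digits j).head? :: s.seen j else s.seen j := by
      funext j
      by_cases hj : j = i
      · subst hj; simp [hL.1]
      · simp [hj]
    simp only [Function.update_self, h₁, h₂, h₃]

end phases

/-! ### Comparison, output of the minima, clean-up, translation of the answer. -/

section phases

variable {V V' : Type} {tm : FinTM2} (eI : tm.Γ tm.k₀ ≃ Γ') (eO : tm.Γ tm.k₁ ≃ Option V)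
  [Fintype V] [Fintype V'] (choice : (V' → V' → Bool) → V → V')

open Stacks TM2

attribute [-simp] stepAux.eq_1 stepAux.eq_2 stepAux.eq_3

local notation "Run" => ReachesIn (extStep tm eI eO choice)

open Classical in
theorem extStep_compare (r : Reg V V') (s : Stacks V V' tm) :
    ∃ r' : Reg V V', r'.le = (fun i j =>
        leStep (s.digits i).head? (s.digits j).head? (r.le i j)) ∧
      extStep tm eI eO choice (cfg .compare r s) =
        if ∀ i, (s.digits i).head? = none then
          some (cfg (.emit (revList V)) r' { s with
            digits := fun i => (s.digits i).tail
            seen := fun i => (s.digits i).head? :: s.seen i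
            sel := choice r'.le :: s.sel })
        else
          some (cfg .compare r' { s with
            digits := fun i => (s.digits i).tail
            seen := fun i => (s.digits i).head? :: s.seen i }) := by
  refine ⟨{ r with
    digit := fun i => (s.digits i).head?
    le := fun i j => leStep (s.digits i).head? (s.digits j).head? (r.le i j) }, rfl, ?_⟩
  rw [extStep_cfg, program]
  refine (congrArg some (stepAux_popDigits (d := Classical.decEq _) _ _ (allList V').2 _ _)).trans ?_
  have h : ∀ i, i ∈ (allList V').1 := fun i => by simp [allList]
  simp only [h, if_true]
  split_ifs with h'
  · simp [h', cfg]
  · have h₁ : decide (∀ i, s.digits i = []) = false := by simpa using h'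
    simp [h₁, cfg]

/-- By `leStep_lex` every pass preserves the lexicographic verdict, which the table holds once the
digits are exhausted. The final pass finds all digit stacks empty and only adds padding, whence the
extra `1` in both bounds; `reduceOption` removes the padding. -/
theorem run_compare (k : ℕ) (r : Reg V V') (s : Stacks V V' tm)
    (hk : ∀ i, (s.digits i).length ≤ k) :
    ∃ (r' : Reg V V') (seen' : V' → List (Option Bool)),
      r'.le = (fun i j => decide (ofBits (s.digits i) < ofBits (s.digits j) ∨
        (ofBits (s.digits i) = ofBits (s.digits j) ∧ r.le i j = true))) ∧
      (∀ i, (seen' i).reduceOption = (s.digits i).reverse ++ (s.seen i).reduceOption ∧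
        (seen' i).length ≤ (s.seen i).length + k + 1) ∧
      Run (k + 1) (cfg .compare r s) (cfg (.emit (revList V)) r'
        { s with digits := fun _ => [], seen := seen', sel := choice r'.le :: s.sel }) := by
  induction k generalizing r s with
  | zero =>
    have h : ∀ i, s.digits i = [] := fun i => List.length_eq_zero_iff.1 (Nat.le_zero.1 (hk i))
    obtain ⟨r', hr, h₁⟩ := extStep_compare eI eO choice r s
    rw [if_pos (fun i => by simp [h])] at h₁
    refine ⟨r', fun i => none :: s.seen i, ?_, fun i => ?_, .single ?_⟩
    · rw [hr]; funext i j; simp [h, leStep]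
    · simp [h]
    · simpa [h] using h₁
  | succ k ih =>
    obtain ⟨r', hr, h₁⟩ := extStep_compare eI eO choice r s
    by_cases h : ∀ i, (s.digits i).head? = none
    · rw [if_pos h] at h₁
      simp only [List.head?_eq_none_iff] at h
      refine ⟨r', fun i => none :: s.seen i, ?_, fun i => ?_, (ReachesIn.single ?_).mono ?_⟩
      · rw [hr]; funext i j; simp [h, leStep]
      · simp [h]
      · simpa [h] using h₁
      · omega
    · rw [if_neg h] at h₁
      obtain ⟨r₂, seen', hle, hseen, h₂⟩ := ih r' { s with
          digits := fun i => (s.digits i).tail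
          seen := fun i => (s.digits i).head? :: s.seen i } fun i => by
        have := hk i
        simp only [List.length_tail]
        omega
      refine ⟨r₂, seen', ?_, fun i => ⟨?_, ?_⟩, .head h₁ h₂⟩
      · rw [hle, hr]
        funext i j
        exact leStep_lex _ _ _
      · rw [(hseen i).1]
        dsimp only
        cases s.digits i <;> simp
      · have := (hseen i).2
        simp only [List.length_cons] at this
        omega

open Classical in
theorem run_drain (i : V') (L : NodupList V) (b : List (Option Bool)) (w : List Γ')
    (r : Reg V V') (s : Stacks V V' tm) (hs : s.seen i = b)
    (hw : s.inner = onlyStack tm tm.k₀ (w.map eI.symm)) :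
    ∃ r' : Reg V V', r'.le = r.le ∧
      Run (b.length + 1) (cfg (.drain i L) r s) (cfg (.emit L) r' { s with
        inner := onlyStack tm tm.k₀ ((b.reduceOption.reverse.map Γ'.bit ++ w).map eI.symm)
        seen := Function.update s.seen i [] }) := by
  induction b generalizing r s w with
  | nil =>
    refine ⟨{ r with pad := none }, rfl, .head ?_ (.refl 0 _)⟩
    rw [extStep_cfg]
    simp [program, cfg, hs, hw]
  | cons o b ih =>
    cases o with
    | none =>
      obtain ⟨r', hr, h⟩ := ih w { r with pad := some none }
        { s with seen := Function.update s.seen i b } (by simp) hw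
      refine ⟨r', hr, .head ?_ (by simpa using h)⟩
      rw [extStep_cfg]
      simp [program, cfg, hs]
    | some c =>
      obtain ⟨r', hr, h⟩ := ih (.bit c :: w) { r with pad := some (some c) }
        { s with
          inner := onlyStack tm tm.k₀ ((Γ'.bit c :: w).map eI.symm)
          seen := Function.update s.seen i b } (by simp) rfl
      refine ⟨r', hr, .head ?_ (by simpa using h)⟩
      rw [extStep_cfg]
      simp [program, cfg, hs, hw]

/-- Draining `seen (m x)` destroys it, so injectivity of `m` is what keeps the digits for the
remaining vertices intact. The most significant digit is popped first, so the least significant one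
ends on top, as in the encoding. -/
theorem run_emit (m : V → V') (hm : Function.Injective m) (c : V → List Bool) (K : ℕ)
    (L : NodupList V) (w : List Γ') (r : Reg V V') (s : Stacks V V' tm)
    (hr : choice r.le = m)
    (hc : ∀ x ∈ L.1, (s.seen (m x)).reduceOption = (c x).reverse)
    (hK : ∀ i, (s.seen i).length ≤ K)
    (hw : s.inner = onlyStack tm tm.k₀ (w.map eI.symm)) :
    ∃ (r' : Reg V V') (seen' : V' → List (Option Bool)), (∀ i, (seen' i).length ≤ K) ∧
      Run (L.1.length * (K + 2) + 1) (cfg (.emit L) r s) (cfg (.clear (allList V')) r' { s with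
        inner := onlyStack tm tm.k₀ ((Γ'.bra ::
          L.1.reverse.flatMap (fun x => (c x).map Γ'.bit ++ [Γ'.comma]) ++ w).map eI.symm)
        seen := seen' }) := by
  classical
  obtain ⟨L, hL⟩ := L
  induction L generalizing r s w with
  | nil =>
    refine ⟨r, s.seen, hK, .head ?_ (.refl _ _)⟩
    rw [extStep_cfg]
    simp [program, cfg, hw]
  | cons x L ih =>
    have hL' := List.nodup_cons.1 hL
    obtain ⟨r₁, hr₁, h₁⟩ := run_drain eI eO choice (m x) ⟨L, hL'.2⟩ (s.seen (m x))
      (Γ'.comma :: w) r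
      { s with inner := onlyStack tm tm.k₀ ((Γ'.comma :: w).map eI.symm) } rfl rfl
    rw [hc x List.mem_cons_self, List.reverse_reverse] at h₁
    obtain ⟨r₂, seen', hseen, h₂⟩ := ih ((c x).map Γ'.bit ++ Γ'.comma :: w) r₁
      { s with
        inner := onlyStack tm tm.k₀ (((c x).map Γ'.bit ++ Γ'.comma :: w).map eI.symm)
        seen := Function.update s.seen (m x) [] } (by rw [hr₁, hr])
      (fun i => by
        by_cases hi : i = m x
        · subst hi; simp
        · simpa [hi] using hK i) rfl hL'.2
      (fun y hy => by
        have : m y ≠ m x := fun e => hL'.1 (hm e ▸ hy)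
        simpa [this] using hc y (List.mem_cons_of_mem _ hy))
    refine ⟨r₂, seen', hseen, ?_⟩
    have h₀ : extStep tm eI eO choice (cfg (.emit ⟨x :: L, hL⟩) r s) =
        some (cfg (.drain (m x) ⟨L, hL'.2⟩) r
          { s with inner := onlyStack tm tm.k₀ ((Γ'.comma :: w).map eI.symm) }) := by
      rw [extStep_cfg]
      simp [program, cfg, hw, hr]
    have h₃ := (ReachesIn.head h₀ (h₁.trans h₂)).mono
      (t' := (x :: L).length * (K + 2) + 1) (by
        have := hK (m x)
        simp only [List.length_cons, Nat.succ_mul]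
        omega)
    simpa using h₃

-- Digits of colors that were not selected are still stored; the next block needs empty stacks.
open Classical in
theorem run_clear (K : ℕ) (L : NodupList V') (r : Reg V V') (s : Stacks V V' tm)
    (hK : ∀ i, (s.seen i).length ≤ K) :
    ∃ r' : Reg V V', Run (L.1.length * (K + 1) + 1) (cfg (.clear L) r s) (cfg .block r'
      { s with seen := fun i => if i ∈ L.1 then [] else s.seen i }) := by
  obtain ⟨L, hL⟩ := L
  induction L generalizing r s with
  | nil =>
    refine ⟨r, .head ?_ (.refl _ _)⟩
    rw [extStep_cfg]
    simp [program, cfg]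
  | cons i L ih =>
    have hL' := List.nodup_cons.1 hL
    have one : ∀ (b : List (Option Bool)) (r : Reg V V') (s : Stacks V V' tm), s.seen i = b →
        ∃ r' : Reg V V', Run (b.length + 1) (cfg (.clear ⟨i :: L, hL⟩) r s)
          (cfg (.clear ⟨L, hL'.2⟩) r' { s with seen := Function.update s.seen i [] }) := by
      intro b
      induction b with
      | nil =>
        intro r s hs
        refine ⟨{ r with pad := none }, .head ?_ (.refl 0 _)⟩
        rw [extStep_cfg]
        simp [program, cfg, hs]
      | cons o b ihb =>
        intro r s hs
        obtain ⟨r', h⟩ := ihb { r with pad := some o }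
          { s with seen := Function.update s.seen i b } (by simp)
        refine ⟨r', .head ?_ (by simpa using h)⟩
        rw [extStep_cfg]
        simp [program, cfg, hs]
    obtain ⟨r₁, h₁⟩ := one _ r s rfl
    obtain ⟨r₂, h₂⟩ := ih r₁ { s with seen := Function.update s.seen i [] } (fun j => by
        by_cases hj : j = i
        · subst hj; simp
        · simpa [hj] using hK j) hL'.2
    refine ⟨r₂, ?_⟩
    have h₃ := (h₁.trans h₂).mono (t' := (i :: L).length * (K + 1) + 1) (by
        have := hK i
        simp only [List.length_cons, Nat.succ_mul]
        omega)
    have h₄ : (fun j => if j ∈ L then [] else Function.update s.seen i [] j) =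
        fun j => if j ∈ i :: L then [] else s.seen j := by
      funext j
      by_cases hj : j = i
      · subst hj; simp
      · simp [hj]
    simpa only [h₄] using h₃

theorem run_copyMatrix (w : List Γ') (r : Reg V V') (s : Stacks V V' tm)
    (hw : s.inner = onlyStack tm tm.k₀ (w.map eI.symm)) :
    ∃ r' : Reg V V', Run (s.mat.length + 1) (cfg .copyMatrix r s) (cfg (.run tm.main) r' { s with
      inner := onlyStack tm tm.k₀ ((s.mat.reverse ++ w).map eI.symm)
      mat := [] }) := by
  obtain ⟨m, hm⟩ : ∃ m, s.mat = m := ⟨_, rfl⟩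
  rw [hm]
  induction m generalizing r s w with
  | nil =>
    refine ⟨{ r with sym := none }, .head ?_ (.refl 0 _)⟩
    rw [extStep_cfg]
    simp [program, cfg, hm, hw]
  | cons c m ih =>
    obtain ⟨r', h⟩ := ih (c :: w) { r with sym := some c }
      { s with inner := onlyStack tm tm.k₀ ((c :: w).map eI.symm), mat := m } rfl rfl
    refine ⟨r', .head ?_ (by simpa using h)⟩
    rw [extStep_cfg]
    simp [program, cfg, hm, hw]

theorem run_reject (r : Reg V V') (s : Stacks V V' tm) :
    ∃ r' : Reg V V', Run (s.sel.length + 1) (cfg .reject r s)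
      (cfg .finish r' { s with sel := [] }) := by
  obtain ⟨m, hm⟩ : ∃ m, s.sel = m := ⟨_, rfl⟩
  rw [hm]
  induction m generalizing r s with
  | nil =>
    refine ⟨{ r with sel := none }, .head ?_ (.refl 0 _)⟩
    rw [extStep_cfg]
    simp [program, cfg, hm]
  | cons c m ih =>
    obtain ⟨r', h⟩ := ih { r with sel := some c } { s with sel := m } rfl
    refine ⟨r', .head ?_ (by simpa using h)⟩
    rw [extStep_cfg]
    simp [program, cfg, hm]

theorem run_finish (r : Reg V V') (s : Stacks V V' tm) :
    Run (s.tmp.length + 1) (cfg .finish r s)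
      ⟨none, (tm.initialState, .init V V'),
        { s with tmp := [], out := s.tmp.reverse ++ s.out }.get⟩ := by
  obtain ⟨m, hm⟩ : ∃ m, s.tmp = m := ⟨_, rfl⟩
  rw [hm]
  induction m generalizing r s with
  | nil =>
    refine .head ?_ (.refl 0 _)
    rw [extStep_cfg]
    simp [program, hm]
  | cons c m ih =>
    have h := ih { r with color' := some c } { s with tmp := m, out := c :: s.out } rfl
    refine .head ?_ (by simpa using h)
    rw [extStep_cfg]
    simp [program, cfg, hm]

/-- The saved maps and the colors lie in the same vertex order, so the two stacks are popped
together. -/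
theorem run_colors_some (l : List ((V → V') × V)) (r : Reg V V') (s : Stacks V V' tm)
    (hs : s.sel = l.map Prod.fst)
    (hw : s.inner = onlyStack tm tm.k₁ ((l.map fun a => some a.2).map eO.symm)) :
    ∃ r' : Reg V V', Run (l.length + 1) (cfg .colors r s) (cfg .finish r' { s with
      inner := fun _ => []
      sel := []
      tmp := (l.map fun a => some (a.1 a.2)).reverse ++ s.tmp }) := by
  have hnil : onlyStack tm tm.k₁ [] = fun _ => [] := Function.update_eq_self ..
  induction l generalizing r s with
  | nil =>
    refine ⟨{ r with color := none }, .head ?_ (.refl 0 _)⟩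
    rw [extStep_cfg]
    obtain ⟨_, _, _, _, _⟩ := s
    simp only [List.map_nil] at hs hw
    subst hs hw
    simp [program, cfg, hnil]
  | cons a l ih =>
    obtain ⟨r', h⟩ := ih { r with color := some (some a.2), sel := some a.1 } { s with
        inner := onlyStack tm tm.k₁ ((l.map fun a => some a.2).map eO.symm)
        sel := l.map Prod.fst
        tmp := some (a.1 a.2) :: s.tmp } rfl rfl
    refine ⟨r', .head ?_ (by simpa using h)⟩
    rw [extStep_cfg]
    simp [program, cfg, hs, hw]

/-- This answer has one letter only, so the saved maps must be discarded separately: a halting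
configuration has all stacks but the output empty. -/
theorem run_colors_none (r : Reg V V') (s : Stacks V V' tm)
    (hw : s.inner = onlyStack tm tm.k₁ [eO.symm none]) :
    ∃ r' : Reg V V', Run (s.sel.length + 2) (cfg .colors r s) (cfg .finish r' { s with
      inner := fun _ => []
      sel := []
      tmp := none :: s.tmp }) := by
  have hnil : onlyStack tm tm.k₁ [] = fun _ => [] := Function.update_eq_self ..
  obtain ⟨r', h⟩ := run_reject eI eO choice { r with color := some none, sel := s.sel.head? }
    { s with inner := fun _ => [], sel := s.sel.tail, tmp := none :: s.tmp }
  refine ⟨r', (ReachesIn.head ?_ h).mono (by simp)⟩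
  rw [extStep_cfg]
  simp [program, cfg, hw, hnil]

end phases

/-! ### Simulation of the inner machine. -/

section inner

variable {V V' : Type} {tm : FinTM2}

open TM2

attribute [-simp] stepAux.eq_1 stepAux.eq_2 stepAux.eq_3

/-- An embedded statement touches only the inner stacks and state; where the inner machine would
halt, control passes to `colors`. -/
theorem stepAux_embed [d : DecidableEq (tm.K ⊕ WorkStack V')]
    (q : TM2.Stmt tm.Γ tm.Λ tm.σ) (v : tm.σ) (r : Reg V V') (s : Stacks V V' tm) :
    stepAux (embed tm q) (v, r) s.get =
      ⟨some ((stepAux q v s.inner).l.elim .colors .run), ((stepAux q v s.inner).var, r),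
        { s with inner := (stepAux q v s.inner).stk }.get⟩ := by
  induction q generalizing v s with
  | push k f q ih => simp [embed, ih, stepAux.eq_1]
  | peek k f q ih => exact ih _ _
  | pop k f q ih => exact (Stacks.stepAux_pop_inner s (v, r) (embed tm q) k _).trans (ih _ _)
  | load f q ih => simp [embed, ih]
  | branch f q₁ q₂ ih₁ ih₂ => cases h : f v <;> simp [embed, ih₁, ih₂, h]
  | goto f => rfl
  | halt => rfl

variable (eI : tm.Γ tm.k₀ ≃ Γ') (eO : tm.Γ tm.k₁ ≃ Option V)
  [Fintype V] [Fintype V'] (choice : (V' → V' → Bool) → V → V')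

theorem run_inner_cfg (r : Reg V V') (s : Stacks V V' tm) (n : ℕ) (a b : tm.Cfg)
    (h : (flip bind tm.step)^[n] (some a) = some b) :
    ReachesIn (extStep tm eI eO choice) n
      ⟨some (a.l.elim .colors .run), (a.var, r), { s with inner := a.stk }.get⟩
      ⟨some (b.l.elim .colors .run), (b.var, r), { s with inner := b.stk }.get⟩ := by
  induction n generalizing a with
  | zero =>
    cases h
    exact .refl _ _
  | succ n ih =>
    rw [Function.iterate_succ_apply] at h
    obtain ⟨l, v, S⟩ := a
    cases l with
    | none =>
      have h₀ : ∀ n, (flip bind tm.step)^[n] none = none := fun n => by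
        induction n with
        | zero => rfl
        | succ n ih => rw [Function.iterate_succ_apply]; exact ih
      exact absurd ((h₀ n).symm.trans h) (by simp)
    | some l =>
      exact .head (congrArg some (stepAux_embed (d := Classical.decEq _) (tm.m l) v r
        { s with inner := S })) (ih (stepAux (tm.m l) v S) h)

theorem run_inner (w : List (tm.Γ tm.k₀)) (w' : List (tm.Γ tm.k₁)) (t : ℕ)
    (h : TM2OutputsInTime tm w (some w') t) (r : Reg V V') (s : Stacks V V' tm)
    (hw : s.inner = onlyStack tm tm.k₀ w) :
    ReachesIn (extStep tm eI eO choice) t (cfg (.run tm.main) r s)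
      (cfg .colors r { s with inner := onlyStack tm tm.k₁ w' }) := by
  obtain ⟨⟨n, hn⟩, ht⟩ := h
  rw [initList_eq] at hn
  simp only [Option.map_some, haltList_eq] at hn
  have := run_inner_cfg eI eO choice r s n _ _ hn
  simp only [← hw] at this
  exact this.mono ht

end inner

/-! ### Lengths of encodings. -/

namespace Input

variable {V V' : Type} (I : Input V')

theorem encodeCost_eq (u : Fin I.n) (i : V') :
    I.encodeCost u i = (bits (I.cost u i)).map Γ'.bit ++ [Γ'.comma] := rfl

theorem reverse_encodeCosts [Fintype V'] (u : Fin I.n) :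
    (I.encodeCosts u).reverse = Γ'.ket :: (revList V').1.flatMap
      (fun i => Γ'.comma :: (bits (I.cost u i)).reverse.map Γ'.bit) ++ [Γ'.bra] := by
  simp [encodeCosts, encodeCost_eq, revList, List.reverse_flatMap, Function.comp_def]

/-- Since `I.cheapest hp u` is injective, the contracted code lengths sum over a subset of the
original colors. -/
theorem length_encodeCosts_contract [Fintype V] [Fintype V'] {p : V' → V}
    (hp : Function.Surjective p)
    (u : Fin I.n) :
    ((I.contract hp).encodeCosts u).length ≤ (I.encodeCosts u).length := by
  have h := Finset.sum_map (Finset.univ : Finset V)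
    ⟨I.cheapest hp u, fibreMin_injective hp _⟩ (fun i => (I.encodeCost u i).length)
  have h' : ∑ x : V, ((I.contract hp).encodeCost u x).length ≤
      ∑ i : V', (I.encodeCost u i).length :=
    h.symm.le.trans (Finset.sum_le_sum_of_subset (Finset.subset_univ _))
  simpa [encodeCosts, List.length_flatMap, Finset.sum_toList] using h'

theorem length_encode_contract [Fintype V] [Fintype V'] {p : V' → V} (hp : Function.Surjective p) :
    (I.contract hp).encode.length ≤ I.encode.length := by
  have h : ((List.finRange I.n).flatMap (I.contract hp).encodeCosts).length ≤
      ((List.finRange I.n).flatMap I.encodeCosts).length := by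
    refine (List.length_flatMap (l := List.finRange I.n)).trans_le ?_
    rw [List.length_flatMap]
    exact List.sum_le_sum fun u _ => I.length_encodeCosts_contract hp u
  have e : (List.finRange (I.contract hp).n).flatMap (I.contract hp).encodeRow =
      (List.finRange I.n).flatMap I.encodeRow := rfl
  unfold encode
  rw [e]
  simp only [List.length_append]
  exact Nat.add_le_add_left h _

theorem ket_notMem_encodeRow (u : Fin I.n) : Γ'.ket ∉ I.encodeRow u := by
  simp [encodeRow, List.mem_ofFn]

/-- Each row has at least its closing comma. This bounds the postprocessing time in terms of the
input length. -/
theorem le_length_encodeRows : I.n ≤ ((List.finRange I.n).flatMap I.encodeRow).length := by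
  rw [List.length_flatMap]
  have h : ((List.finRange I.n).map fun _ => 1).sum ≤
      ((List.finRange I.n).map fun u => (I.encodeRow u).length).sum :=
    List.sum_le_sum fun u _ => by simp [encodeRow]
  simpa using h

end Input

/-! ### Contraction of the cost blocks. -/

section contraction

variable {V V' : Type} {tm : FinTM2} (eI : tm.Γ tm.k₀ ≃ Γ') (eO : tm.Γ tm.k₁ ≃ Option V)
  [Fintype V] [Fintype V'] {p : V' → V} (hp : Function.Surjective p)

open Stacks TM2

attribute [-simp] stepAux.eq_1 stepAux.eq_2 stepAux.eq_3

local notation "Run" => ReachesIn (extStep tm eI eO (fibreMin hp))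

theorem run_block (I : Input V') (u : Fin I.n) (R w : List Γ') (r : Reg V V')
    (s : Stacks V V' tm) (hs : s.rev = (I.encodeCosts u).reverse ++ R)
    (hd : s.digits = fun _ => []) (hseen : s.seen = fun _ => [])
    (hw : s.inner = onlyStack tm tm.k₀ (w.map eI.symm)) :
    ∃ r', Run ((4 + 2 * Fintype.card V + Fintype.card V') * (I.encodeCosts u).length)
      (cfg .block r s) (cfg .block r' { s with
        rev := R
        inner := onlyStack tm tm.k₀ (((I.contract hp).encodeCosts u ++ w).map eI.symm)
        sel := I.cheapest hp u :: s.sel }) := by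
  classical
  have hlen : (I.encodeCosts u).length = ((revList V').1.flatMap
      (fun i => Γ'.comma :: (bits (I.cost u i)).reverse.map Γ'.bit)).length + 2 := by
    rw [← List.length_reverse, I.reverse_encodeCosts u]
    simp
  rw [I.reverse_encodeCosts u] at hs
  have hbits : ∀ i, (bits (I.cost u i)).length ≤ ((revList V').1.flatMap
      (fun i => Γ'.comma :: (bits (I.cost u i)).reverse.map Γ'.bit)).length := fun i => by
    rw [List.length_flatMap]
    refine le_trans ?_ (List.single_le_sum (fun _ _ => Nat.zero_le _) _ (List.mem_map_of_mem
      (a := i) (by simp [revList])))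
    simp
  generalize hℓ : ((revList V').1.flatMap
      (fun i => Γ'.comma :: (bits (I.cost u i)).reverse.map Γ'.bit)).length = ℓ at hlen hbits
  have h₀ : extStep tm eI eO (fibreMin hp) (cfg .block r s) =
      some (cfg (.entry (revList V')) { r with sym := some .ket } { s with
        rev := (revList V').1.flatMap
          (fun i => Γ'.comma :: (bits (I.cost u i)).reverse.map Γ'.bit) ++ Γ'.bra :: R
        inner := onlyStack tm tm.k₀ ((Γ'.ket :: w).map eI.symm) }) := by
    rw [extStep_cfg]
    simp [program, cfg, hs, hw]
  obtain ⟨r₁, hr₁, h₁⟩ := run_entry eI eO (fibreMin hp) (fun i => bits (I.cost u i)) R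
    (revList V') { r with sym := some .ket } { s with
        rev := (revList V').1.flatMap
          (fun i => Γ'.comma :: (bits (I.cost u i)).reverse.map Γ'.bit) ++ Γ'.bra :: R
        inner := onlyStack tm tm.k₀ ((Γ'.ket :: w).map eI.symm) } rfl (by simp [hd])
  have hall : ∀ i, i ∈ (revList V').1 := fun i => by simp [revList]
  simp only [hall, if_true, hℓ] at h₁
  obtain ⟨r₂, seen', hr₂, hseen', h₂⟩ := run_compare eI eO (fibreMin hp) ℓ r₁ { s with
    rev := R
    inner := onlyStack tm tm.k₀ ((Γ'.ket :: w).map eI.symm)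
    digits := fun i => bits (I.cost u i) } hbits
  have hle : r₂.le = fun i j => decide (I.cost u i ≤ I.cost u j) := by
    rw [hr₂, hr₁]
    funext i j
    simp [le_iff_lt_or_eq]
  have hm : fibreMin hp r₂.le = I.cheapest hp u := by rw [hle]; rfl
  obtain ⟨r₃, seen₃, hseen₃, h₃⟩ := run_emit eI eO (fibreMin hp) (I.cheapest hp u)
    (fibreMin_injective hp _) (fun x => bits (I.cost u (I.cheapest hp u x))) (ℓ + 1)
    (revList V) (Γ'.ket :: w) r₂ { s with
      rev := R
      inner := onlyStack tm tm.k₀ ((Γ'.ket :: w).map eI.symm)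
      digits := fun _ => []
      seen := seen'
      sel := fibreMin hp r₂.le :: s.sel } hm
    (fun x _ => by simpa [hseen] using (hseen' (I.cheapest hp u x)).1)
    (fun i => by simpa [hseen] using (hseen' i).2) rfl
  obtain ⟨r₄, h₄⟩ := run_clear eI eO (fibreMin hp) (ℓ + 1) (allList V') r₃ { s with
      rev := R
      inner := onlyStack tm tm.k₀ ((Γ'.bra :: (revList V).1.reverse.flatMap (fun x =>
        (bits (I.cost u (I.cheapest hp u x))).map Γ'.bit ++ [Γ'.comma]) ++ Γ'.ket :: w).map eI.symm)
      digits := fun _ => []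
      seen := seen₃
      sel := fibreMin hp r₂.le :: s.sel } hseen₃
  refine ⟨r₄, ?_⟩
  have hfin := (((ReachesIn.head h₀ h₁).trans h₂).trans h₃).trans h₄
  have hall' : ∀ i, i ∈ (allList V').1 := fun i => by simp [allList]
  have henc : Γ'.bra :: (revList V).1.reverse.flatMap (fun x =>
        (bits (I.cost u (I.cheapest hp u x))).map Γ'.bit ++ [Γ'.comma]) ++ Γ'.ket :: w =
      (I.contract hp).encodeCosts u ++ w := by
    have h : (I.contract hp).encodeCosts u = Γ'.bra :: (Finset.univ : Finset V).toList.flatMap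
        (fun x => (bits (I.cost u (I.cheapest hp u x))).map Γ'.bit ++ [Γ'.comma]) ++ [Γ'.ket] := rfl
    rw [h]
    simp [revList]
  simp only [hall', if_true, henc, hm] at hfin
  rw [← hd, ← hseen] at hfin
  refine hfin.mono ?_
  have c₁ : (revList V).1.length = Fintype.card V := by simp [revList]
  have c₂ : (allList V').1.length = Fintype.card V' := by simp [allList]
  rw [hlen, c₁, c₂]
  -- The phases take `3 * ℓ + 5` steps plus `ℓ + 3` per vertex of `H` and `ℓ + 2` per vertex of
  -- `H'`, while the block has length `ℓ + 2`.
  nlinarith [Nat.zero_le (Fintype.card V * ℓ), Nat.zero_le (Fintype.card V' * ℓ)]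

theorem run_blocks (I : Input V') (us : List (Fin I.n)) (w : List Γ') (r : Reg V V')
    (s : Stacks V V' tm) (hs : s.rev = us.flatMap fun u => (I.encodeCosts u).reverse)
    (hd : s.digits = fun _ => []) (hseen : s.seen = fun _ => [])
    (hw : s.inner = onlyStack tm tm.k₀ (w.map eI.symm)) :
    ∃ r', Run ((4 + 2 * Fintype.card V + Fintype.card V') * s.rev.length + 1)
      (cfg .block r s) (cfg .copyMatrix r' { s with
        rev := []
        inner := onlyStack tm tm.k₀
          ((us.reverse.flatMap (fun u : Fin I.n => (I.contract hp).encodeCosts u) ++ w).map eI.symm)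
        sel := us.reverse.map (I.cheapest hp) ++ s.sel }) := by
  induction us generalizing r s w with
  | nil =>
    refine ⟨{ r with sym := none }, .head ?_ (.refl _ _)⟩
    rw [extStep_cfg]
    simp only [List.flatMap_nil] at hs
    simp [program, cfg, hs, hw]
  | cons u us ih =>
    obtain ⟨r₁, h₁⟩ := run_block eI eO hp I u (us.flatMap fun u => (I.encodeCosts u).reverse) w r s
      hs hd hseen hw
    obtain ⟨r₂, h₂⟩ := ih ((I.contract hp).encodeCosts u ++ w) r₁ { s with
      rev := us.flatMap fun u => (I.encodeCosts u).reverse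
      inner := onlyStack tm tm.k₀ (((I.contract hp).encodeCosts u ++ w).map eI.symm)
      sel := I.cheapest hp u :: s.sel } rfl hd hseen rfl
    refine ⟨r₂, ?_⟩
    have h₃ := (h₁.trans h₂).mono
      (t' := (4 + 2 * Fintype.card V + Fintype.card V') * s.rev.length + 1) (by
        rw [hs]
        simp only [List.flatMap_cons, List.length_append, List.length_reverse]
        rw [Nat.mul_add]
        omega)
    simpa using h₃

end contraction

/-! ### The complete run and its polynomial bound. -/

theorem eval_mono (P : Polynomial ℕ) : Monotone fun n => P.eval n := by
  intro a b h
  simp only [Polynomial.eval_eq_sum_range]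
  exact Finset.sum_le_sum fun i _ => Nat.mul_le_mul_left _ (Nat.pow_le_pow_left h i)

section extension

variable {V V' : Type} {tm : FinTM2} (eI : tm.Γ tm.k₀ ≃ Γ') (eO : tm.Γ tm.k₁ ≃ Option V)
  [Fintype V] [Fintype V'] {p : V' → V} (hp : Function.Surjective p)

/-- All stacks are empty. -/
def Stacks.empty (V V' : Type) (tm : FinTM2) : Stacks V V' tm :=
  ⟨fun _ => [], [], [], [], [], [], [], fun _ => [], fun _ => []⟩

theorem get_inp_empty (choice : (V' → V' → Bool) → V → V') (w : List Γ') :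
    onlyStack (extMachine tm eI eO choice) (.inr .inp) w =
      { Stacks.empty V V' tm with inp := w }.get :=
  Function.update_eq_iff.2 ⟨rfl, by
    rintro (_ | _ | _) h <;> first | rfl | exact absurd rfl h⟩

theorem get_out_empty (choice : (V' → V' → Bool) → V → V') (w : List (Option V')) :
    onlyStack (extMachine tm eI eO choice) (.inr .out) w =
      { Stacks.empty V V' tm with out := w }.get :=
  Function.update_eq_iff.2 ⟨rfl, by
    rintro (_ | _ | _) h <;> first | rfl | exact absurd rfl h⟩

local notation "Run" => ReachesIn (extStep tm eI eO (fibreMin hp))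

theorem run_preprocess (I : Input V') :
    ∃ r', Run ((4 + 2 * Fintype.card V + Fintype.card V' + 3) * I.encode.length + 2)
      (cfg .readMatrix (.init V V') { Stacks.empty V V' tm with inp := I.encode })
      (cfg (.run tm.main) r' { Stacks.empty V V' tm with
        inner := onlyStack tm tm.k₀ ((I.contract hp).encode.map eI.symm)
        sel := (List.finRange I.n).map (I.cheapest hp) }) := by
  have hX : Γ'.ket ∉ Γ'.bra :: (List.finRange I.n).flatMap I.encodeRow := by
    simp [List.mem_flatMap, I.ket_notMem_encodeRow]
  have hI : I.encode = (Γ'.bra :: (List.finRange I.n).flatMap I.encodeRow) ++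
      Γ'.ket :: (List.finRange I.n).flatMap I.encodeCosts := by
    simp [Input.encode]
  have hcI : (I.contract hp).encode = (Γ'.bra :: (List.finRange I.n).flatMap I.encodeRow) ++
      Γ'.ket :: (List.finRange I.n).flatMap fun u : Fin I.n => (I.contract hp).encodeCosts u := by
    have h : (I.contract hp).encode = [Γ'.bra] ++ (List.finRange I.n).flatMap I.encodeRow ++
        [Γ'.ket] ++ (List.finRange I.n).flatMap fun u : Fin I.n => (I.contract hp).encodeCosts u :=
      rfl
    rw [h]
    simp
  rw [hcI, hI]
  generalize Γ'.bra :: (List.finRange I.n).flatMap I.encodeRow = X at hX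
  obtain ⟨r₁, h₁⟩ := run_readMatrix eI eO (fibreMin hp) X
    ((List.finRange I.n).flatMap I.encodeCosts) hX (.init V V')
    { Stacks.empty V V' tm with
      inp := X ++ Γ'.ket :: (List.finRange I.n).flatMap I.encodeCosts } rfl
  obtain ⟨r₂, h₂⟩ := run_readCosts eI eO (fibreMin hp) r₁ { Stacks.empty V V' tm with
      inp := (List.finRange I.n).flatMap I.encodeCosts
      mat := Γ'.ket :: X.reverse }
  obtain ⟨r₃, h₃⟩ := run_blocks eI eO hp I (List.finRange I.n).reverse [] r₂
    { Stacks.empty V V' tm with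
      rev := ((List.finRange I.n).flatMap I.encodeCosts).reverse
      mat := Γ'.ket :: X.reverse } List.reverse_flatMap rfl rfl
    (Function.update_eq_self (f := fun _ => []) ..).symm
  obtain ⟨r₄, h₄⟩ := run_copyMatrix eI eO (fibreMin hp)
    ((List.finRange I.n).flatMap fun u : Fin I.n => (I.contract hp).encodeCosts u) r₃
    { Stacks.empty V V' tm with
      inner := onlyStack tm tm.k₀ (((List.finRange I.n).flatMap
        fun u : Fin I.n => (I.contract hp).encodeCosts u).map eI.symm)
      mat := Γ'.ket :: X.reverse
      sel := (List.finRange I.n).map (I.cheapest hp) } rfl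
  refine ⟨r₄, ?_⟩
  simp only [Stacks.empty, List.append_nil, List.reverse_reverse, List.reverse_cons,
    List.append_assoc, List.singleton_append] at h₁ h₂ h₃ h₄ ⊢
  refine (((h₁.trans h₂).trans h₃).trans h₄).mono ?_
  simp only [List.length_append, List.length_cons, List.length_reverse]
  generalize 4 + 2 * Fintype.card V + Fintype.card V' = C
  generalize ((List.finRange I.n).flatMap I.encodeCosts).length = Y
  nlinarith [Nat.zero_le (C * X.length), Nat.zero_le (C * Y)]

theorem run_postprocess (I : Input V') (a : Option (Fin I.n → V)) (r : Reg V V') :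
    Run (2 * I.n + 6)
      (cfg .colors r { Stacks.empty V V' tm with
        inner := onlyStack tm tm.k₁ ((encodeAnswer a).map eO.symm)
        sel := (List.finRange I.n).map (I.cheapest hp) })
      ⟨none, (tm.initialState, .init V V'),
        { Stacks.empty V V' tm with out := encodeAnswer (I.lift hp a) }.get⟩ := by
  cases a with
  | none =>
    obtain ⟨r₁, h₁⟩ := run_colors_none eI eO (fibreMin hp) r { Stacks.empty V V' tm with
        inner := onlyStack tm tm.k₁ ((encodeAnswer (none : Option (Fin I.n → V))).map eO.symm)
        sel := (List.finRange I.n).map (I.cheapest hp) } rfl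
    refine (h₁.trans (run_finish eI eO (fibreMin hp) r₁ _)).mono ?_
    simp [Stacks.empty]
    omega
  | some f =>
    obtain ⟨r₁, h₁⟩ := run_colors_some eI eO (fibreMin hp)
      ((List.finRange I.n).map fun u => (I.cheapest hp u, f u)) r { Stacks.empty V V' tm with
        inner := onlyStack tm tm.k₁ ((encodeAnswer (some f)).map eO.symm)
        sel := (List.finRange I.n).map (I.cheapest hp) }
        (by simp [Function.comp_def]) (by simp [encodeAnswer, List.ofFn_eq_map, Function.comp_def])
    have h₂ := h₁.trans (run_finish eI eO (fibreMin hp) r₁ _)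
    have e : encodeAnswer (I.lift hp (some f)) =
        (List.finRange I.n).map fun u => some (I.cheapest hp u (f u)) := by
      simp [Input.lift, encodeAnswer, List.ofFn_eq_map]
    rw [e]
    simp only [Stacks.empty, List.map_map, Function.comp_def, List.append_nil,
      List.reverse_reverse] at h₂ ⊢
    refine h₂.mono ?_
    simp
    omega

end extension

end MinHom

theorem lemma2p4 {V : Type} [Fintype V] (H : Digraph V) (hH : MinHom.Loopless H)
    (hsolv : MinHom.PolyTimeSolvable H)
    {V' : Type} [Fintype V'] (H' : Digraph V') (hext : MinHom.IsExtension H' H) :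
    MinHom.PolyTimeSolvable H' := by
  obtain ⟨answer, hanswer, ⟨⟨⟨tm, eI, eO⟩, time, hout⟩⟩⟩ := hsolv
  obtain ⟨p, hp, hind, hadj⟩ := hext
  refine ⟨fun I => I.lift hp (answer (I.contract hp)),
    fun I => I.isAnswer_lift hp hH hind hadj _ (hanswer _), ⟨⟨⟨MinHom.extMachine tm eI eO
      (MinHom.fibreMin hp), Equiv.refl _, Equiv.refl _⟩,
      -- Preprocessing contributes the linear term with `3` in place of `5`, plus `2`;
      -- postprocessing takes `2 * I.n + 6` steps, and `I.n` is at most the input length.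
      time + Polynomial.C (4 + 2 * Fintype.card V + Fintype.card V' + 5) * Polynomial.X + 8,
      fun I => Classical.choice ?_⟩⟩⟩
  obtain ⟨r₁, h₁⟩ := MinHom.run_preprocess eI eO hp I
  have h₂ := MinHom.run_inner eI eO (MinHom.fibreMin hp) _ _ _ (hout (I.contract hp)) r₁
    { MinHom.Stacks.empty V V' tm with
      inner := MinHom.onlyStack tm tm.k₀ ((I.contract hp).encode.map eI.symm)
      sel := (List.finRange I.n).map (I.cheapest hp) } rfl
  have h₃ := MinHom.run_postprocess eI eO hp I (answer (I.contract hp)) r₁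
  obtain ⟨n, hn, h⟩ := (h₁.trans h₂).trans h₃
  refine ⟨⟨⟨n, ?_⟩, hn.trans ?_⟩⟩
  · refine Eq.trans ?_ (h.trans ?_)
    · refine congrArg (fun c => (flip bind (MinHom.extStep tm eI eO (MinHom.fibreMin hp)))^[n]
        (some c)) ((MinHom.initList_eq _ _).trans ?_)
      exact congrArg (fun S => (⟨some .readMatrix, (tm.initialState, .init V V'), S⟩ :
          Turing.TM2.Cfg (MinHom.Alphabet V V' tm) (MinHom.Lab V V' tm.Λ)
            (tm.σ × MinHom.Reg V V')))
        ((congrArg _ (List.map_id _)).trans (MinHom.get_inp_empty eI eO (MinHom.fibreMin hp) _))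
    · refine congrArg some (Eq.symm ?_)
      refine (MinHom.haltList_eq (MinHom.extMachine tm eI eO (MinHom.fibreMin hp)) _).trans ?_
      exact congrArg (fun S => (⟨none, (tm.initialState, .init V V'), S⟩ :
          Turing.TM2.Cfg (MinHom.Alphabet V V' tm) (MinHom.Lab V V' tm.Λ)
            (tm.σ × MinHom.Reg V V')))
        ((congrArg _ (List.map_id _)).trans (MinHom.get_out_empty eI eO (MinHom.fibreMin hp) _))
  · have h₄ := MinHom.eval_mono time (I.length_encode_contract hp)
    have h₅ : I.n ≤ I.encode.length := by
      refine I.le_length_encodeRows.trans ?_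
      simp only [MinHom.Input.encode, List.length_append]
      omega
    simp only [Polynomial.eval_add, Polynomial.eval_mul, Polynomial.eval_C, Polynomial.eval_X,
      Polynomial.eval_ofNat]
    dsimp only at h₄
    nlinarith
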